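/- Let $X$ be a Tychonoff space (not necessarily compact). In the open-open game on $X$, players I and II alternate for countably many rounds: in round $n$ player I chooses a non-empty open set and player II chooses a non-empty open subset $U_n$ of it. Player I wins if $\bigcup_n U_n$ is dense in $X$. The space $X$ is called I-favorable if player I has a winning strategy. A set $C\subset X$ is canonically closed if it is the closure of its interior. A quasi $\kappa$-metric on $X$ is a function $\rho(x,C)\ge 0$ of a point $x\in X$ and a canonically closed set $C\subset X$ such that - K1*) for any $C$ there is a dense open subset $V$ of $X\setminus C$ such that $\rho(x,C)=0$ if and only if $x\in X\setminus V$; - K2) if $C\subset C'$, then $\rho(x,C')\le\rho(x,C)$ for every $x\in X$; - K3) for every $C$ the function $x\mapsto\rho(x,C)$ is continuous; - K4) $\rho\bigl(x,\overline{\bigcup_\alpha C_\alpha}\bigr)=\inf_\alpha\rho(x,C_\alpha)$ for every $x\in X$ and every non-empty increasing transfinite family $\{C_\alpha\}$ of canonically closed sets in $X$. The space $X$ is quasi $\kappa$-metrizable if there is a quasi $\kappa$-metric on it. **Statement.** Every I-favorable Tychonoff space $X$ is quasi $\kappa$-metrizable. Moreover, there is a quasi $\kappa$-metric $d$ on the Stone–Čech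 compactification $\beta X$ such that $d_X(x,C)=d\bigl(x,\overline{C}^{\beta X}\bigr)$, for $x\in X$ and $C$ canonically closed in $X$, defines a quasi $\kappa$-metric on $X$. -/

import Mathlib

open TopologicalSpace

universe u

/-- The nonempty open subsets of `X`: the legal moves in the open-open game. -/
abbrev NonemptyOpens (X : Type*) [TopologicalSpace X] : Type _ :=
  {U : Opens X // (U : Set X).Nonempty}

/-- `X` is I-favorable: player I has a winning strategy in the open-open game.
A strategy `σ` sends the list `U 0, …, U (n - 1)` of player II's previous moves to player I's
next move; player II answers with a nonempty open `U n` contained in it; player I wins if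
the union of all the `U n` is dense. -/
def IsIFavorable (X : Type*) [TopologicalSpace X] : Prop :=
  ∃ σ : List (NonemptyOpens X) → NonemptyOpens X,
    ∀ U : ℕ → NonemptyOpens X,
      (∀ n, U n ≤ σ (List.ofFn fun i : Fin n => U i)) →
        Dense (⋃ n, ((U n : Opens X) : Set X))

/-- The canonically (regularly) closed subsets of `X`, ordered by inclusion. -/
abbrev CanonicallyClosed (X : Type*) [TopologicalSpace X] : Type _ :=
  {C : Set X // closure (interior C) = C}

/-- The closure of the union of a family of canonically closed sets, which is canonically closed. -/
def CanonicallyClosed.closureUnion {X ι : Type*} [TopologicalSpace X]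
    (C : ι → CanonicallyClosed X) : CanonicallyClosed X :=
  ⟨closure (⋃ i, (C i : Set X)), by
    apply subset_antisymm
    · exact closure_minimal interior_subset isClosed_closure
    · refine closure_minimal (Set.iUnion_subset fun i => ?_) isClosed_closure
      calc (C i : Set X) = closure (interior (C i : Set X)) := (C i).2.symm
        _ ⊆ _ := closure_mono (interior_mono
          ((Set.subset_iUnion (fun i => (C i : Set X)) i).trans subset_closure))⟩

/-- `ρ` is a quasi `κ`-metric on `X`: a nonnegative function of a point and a canonically closed
set that satisfies the axioms K1*, K2, K3 and K4. -/
structure IsQuasiKappaMetric {X : Type u} [TopologicalSpace X]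
    (ρ : X → CanonicallyClosed X → ℝ) : Prop where
  nonneg : ∀ x C, 0 ≤ ρ x C
  /-- K1*: there is a dense open subset `V` of `X \ C` such that `ρ x C = 0` iff `x ∈ X \ V`. -/
  zero_iff : ∀ C : CanonicallyClosed X, ∃ V : Set X, IsOpen V ∧ V ⊆ (C : Set X)ᶜ ∧
    (C : Set X)ᶜ ⊆ closure V ∧ ∀ x, ρ x C = 0 ↔ x ∈ Vᶜ
  /-- K2 -/
  anti : ∀ C C' : CanonicallyClosed X, (C : Set X) ⊆ (C' : Set X) → ∀ x, ρ x C' ≤ ρ x C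
  /-- K3 -/
  continuous : ∀ C, Continuous fun x => ρ x C
  /-- K4, for every (nonempty) increasing transfinite family of canonically closed sets. -/
  closureUnion : ∀ (ι : Type u) [LinearOrder ι] [WellFoundedLT ι] [Nonempty ι]
    (C : ι → CanonicallyClosed X), Monotone C →
      ∀ x, ρ x (CanonicallyClosed.closureUnion C) = ⨅ i, ρ x (C i)

/-- A space is quasi `κ`-metrizable if there is a quasi `κ`-metric on it. -/
def QuasiKappaMetrizable (X : Type*) [TopologicalSpace X] : Prop :=
  ∃ ρ : X → CanonicallyClosed X → ℝ, IsQuasiKappaMetric ρ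

/-- The closure in `βX` of a canonically closed subset of the Tychonoff space `X`, which is
canonically closed in `βX`. -/
def CanonicallyClosed.closureStoneCech {X : Type*} [TopologicalSpace X] [T35Space X]
    (C : CanonicallyClosed X) : CanonicallyClosed (StoneCech X) :=
  ⟨closure (stoneCechUnit '' (C : Set X)), by
    apply subset_antisymm
    · exact closure_minimal interior_subset isClosed_closure
    · refine closure_minimal ?_ isClosed_closure
      have h : stoneCechUnit '' interior (C : Set X) ⊆
          interior (closure (stoneCechUnit '' (C : Set X))) := by
        rintro _ ⟨x, hx, rfl⟩
        exact mem_interior_iff_mem_nhds.2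
          (isDenseInducing_stoneCechUnit.closure_image_mem_nhds (mem_interior_iff_mem_nhds.1 hx))
      calc stoneCechUnit '' (C : Set X) = stoneCechUnit '' closure (interior (C : Set X)) := by
            rw [C.2]
        _ ⊆ closure (stoneCechUnit '' interior (C : Set X)) :=
            image_closure_subset_closure_image continuous_stoneCechUnit
        _ ⊆ _ := closure_mono h⟩

/-- The restriction to `X` of a function `d` of points and canonically closed sets of `βX`:
`(x, C) ↦ d (x, closure of C in βX)`. -/
def restrictStoneCech {X : Type*} [TopologicalSpace X] [T35Space X]
    (d : StoneCech X → CanonicallyClosed (StoneCech X) → ℝ) : X → CanonicallyClosed X → ℝ :=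
  fun x C => d (stoneCechUnit x) C.closureStoneCech

/-! Player I's winning strategy passes from `X` to `βX`, and a quasi `κ`-metric on `βX` restricts to
`X`, so it is enough to treat a completely regular I-favorable space. Its open sets are represented
by the positivity sets of continuous functions. A set of functions closed under the strategy and the
lattice operations is a regular subfamily: the game yields upper projections to it of all nonempty
open sets (`exists_forall_subset_meets`). Iterating elementary chains down through the cardinals
(`OpsClosed.exists_rank`) arranges all functions in countable blocks, each initial segment being a
finite union of regular subfamilies. Finitely many projections therefore suffice at each block, and
every finite linked family has a finite linked rank-closed extension
(`IsRankedFamily.exists_isRankClosed`). Two such families are linked to each other as soon as they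
agree on the blocks they share (`IsRankClosed.inter_nonempty`).

The distance from `x` to `C` is the supremum of the weights at `x` of the families good for the
complement of `C`. Monotonicity and lower semicontinuity are immediate. The rest is compactness: a
weight bounded below bounds the size and the indices of a family, so an ultrafilter of such families
has a finite limit, which is again good (`IsRankedFamily.exists_isGood_limit`). This gives upper
semicontinuity and K4 at once. -/

/-! ### Closure under finitary operations, and well-ordering in countable blocks. -/

section FinitaryClosure

open Cardinal

variable {A : Type u}

/-- `E` is closed under the countable family `ops` of operations on lists. -/
def OpsClosed (ops : ℕ → List A → A) (E : Set A) : Prop :=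
  ∀ k l, (∀ a ∈ l, a ∈ E) → ops k l ∈ E

theorem List.exists_forall_mem_of_directed {ι : Type*} [Nonempty ι] {E : ι → Set A}
    (hE : Directed (· ⊆ ·) E) (l : List A) (hl : ∀ a ∈ l, a ∈ ⋃ i, E i) :
    ∃ i, ∀ a ∈ l, a ∈ E i := by
  induction l with
  | nil => exact ⟨Classical.arbitrary ι, by simp⟩
  | cons a l ih =>
    obtain ⟨i, hi⟩ := ih fun b hb => hl b (List.mem_cons_of_mem _ hb)
    obtain ⟨j, hj⟩ := Set.mem_iUnion.1 (hl a List.mem_cons_self)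
    obtain ⟨k, hik, hjk⟩ := hE i j
    refine ⟨k, fun b hb => ?_⟩
    rcases List.mem_cons.1 hb with rfl | hb
    exacts [hjk hj, hik (hi b hb)]

theorem OpsClosed.iUnion {ops : ℕ → List A → A} {ι : Type*} [Nonempty ι] {E : ι → Set A}
    (hE : Directed (· ⊆ ·) E) (h : ∀ i, OpsClosed ops (E i)) : OpsClosed ops (⋃ i, E i) := by
  intro k l hl
  obtain ⟨i, hi⟩ := List.exists_forall_mem_of_directed hE l hl
  exact Set.mem_iUnion_of_mem i (h i k l hi)

/-- The smallest set containing `S` that is closed under `ops`. -/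
def opsClosure (ops : ℕ → List A → A) (S : Set A) : Set A :=
  ⋂₀ {E | OpsClosed ops E ∧ S ⊆ E}

theorem subset_opsClosure (ops : ℕ → List A → A) (S : Set A) : S ⊆ opsClosure ops S :=
  Set.subset_sInter fun _ h => h.2

theorem opsClosure_subset {ops : ℕ → List A → A} {S E : Set A} (hE : OpsClosed ops E)
    (h : S ⊆ E) : opsClosure ops S ⊆ E :=
  Set.sInter_subset_of_mem ⟨hE, h⟩

theorem opsClosed_opsClosure (ops : ℕ → List A → A) (S : Set A) :
    OpsClosed ops (opsClosure ops S) := fun k l hl => by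
  rintro E ⟨hE, hS⟩
  exact hE k l fun a ha => hl a ha E ⟨hE, hS⟩

theorem opsClosure_mono (ops : ℕ → List A → A) {S T : Set A} (h : S ⊆ T) :
    opsClosure ops S ⊆ opsClosure ops T :=
  opsClosure_subset (opsClosed_opsClosure ops T) (h.trans (subset_opsClosure ops T))

/-- The closure is reached after `ω` stages, each adding one value for every operation and every
finite list from the previous stage. -/
theorem mk_opsClosure_le (ops : ℕ → List A → A) (S : Set A) :
    #(opsClosure ops S) ≤ max ℵ₀ #S := by
  let step : Set A → Set A := fun T =>
    T ∪ Set.range fun x : ℕ × List T => ops x.1 (x.2.map Subtype.val)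
  have hstep : ∀ T : Set A, #T ≤ max ℵ₀ #S → #(step T) ≤ max ℵ₀ #S := by
    intro T hT
    have hinf : ℵ₀ ≤ max ℵ₀ #S := le_max_left _ _
    refine (mk_union_le _ _).trans (add_le_of_le hinf hT (mk_range_le.trans ?_))
    have hl : #(List T) ≤ max ℵ₀ #S := (mk_list_le_max T).trans (max_le hinf hT)
    rw [mk_prod]
    simpa using mul_le_of_le hinf hinf hl
  let stage : ℕ → Set A := fun n => step^[n] S
  have hsucc : ∀ n, stage (n + 1) = step (stage n) := fun n => Function.iterate_succ_apply' ..
  have hmono : Monotone stage := monotone_nat_of_le_succ fun n => by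
    rw [hsucc]; exact Set.subset_union_left
  have hcard : ∀ n, #(stage n) ≤ max ℵ₀ #S := by
    intro n
    induction n with
    | zero => exact le_max_right _ _
    | succ n ih => rw [hsucc]; exact hstep _ ih
  have hclosed : OpsClosed ops (⋃ n, stage n) := by
    intro k l hl
    obtain ⟨n, hn⟩ := List.exists_forall_mem_of_directed
      (directed_of_isDirected_le fun _ _ h => hmono h) l hl
    refine Set.mem_iUnion_of_mem (n + 1) ?_
    rw [hsucc]
    refine Or.inr ⟨(k, l.attachWith _ hn), ?_⟩
    simp
  refine (mk_le_mk_of_subset (opsClosure_subset hclosed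
    (Set.subset_iUnion stage 0))).trans ?_
  have h := mk_iUnion_le_lift stage
  simp only [lift_uzero, mk_nat, lift_aleph0] at h
  refine h.trans (mul_le_of_le (le_max_left _ _) (le_max_left _ _) (ciSup_le' fun n => ?_))
  simpa using hcard n

/-- Every set closed under countably many finitary operations can be ordered in countable blocks,
numbered by ordinals, so that the union of the blocks before any given one is a finite union of
closed sets. -/
theorem OpsClosed.exists_rank {ops : ℕ → List A → A} {E : Set A} (hE : OpsClosed ops E) :
    ∃ (rank : A → Ordinal.{u}) (idx : A → ℕ),
      (∀ a ∈ E, ∀ b ∈ E, rank a = rank b → idx a = idx b → a = b) ∧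
      ∀ ξ, ∃ F : Set (Set A), F.Finite ∧ (∀ G ∈ F, OpsClosed ops G) ∧
        {a | a ∈ E ∧ rank a < ξ} = ⋃₀ F := by
  induction hc : #E using WellFoundedLT.induction generalizing E with
  | _ κ ih =>
  subst hc
  rcases le_or_gt #E ℵ₀ with hcount | hunc
  · obtain ⟨f, hf⟩ := (Set.countable_iff_exists_injOn (s := E)).1
      (le_aleph0_iff_set_countable.1 hcount)
    refine ⟨fun _ => 0, f, fun a ha b hb _ h => hf ha hb h, fun ξ => ?_⟩
    rcases eq_or_ne ξ 0 with rfl | hξ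
    · exact ⟨∅, by simp⟩
    · exact ⟨{E}, by simp, by simpa using hE, by simp [pos_iff_ne_zero.2 hξ]⟩
  · obtain ⟨r, hr, hord⟩ := exists_ord_eq E
    classical
    let pos : A → Ordinal.{u} := fun a => if h : a ∈ E then Ordinal.typein r ⟨a, h⟩ else 0
    have hpos_lt : ∀ a ∈ E, pos a < (#E).ord := fun a ha => by
      simp only [pos, ha, dif_pos]
      rw [hord]; exact Ordinal.typein_lt_type r _
    have hpos_inj : Set.InjOn pos E := fun a ha b hb h => by
      simp only [pos, ha, hb, dif_pos] at h
      simpa using Ordinal.typein_injective r h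
    -- `E` is an increasing union of closed sets of smaller cardinality, to which the induction
    -- hypothesis applies.
    let B : Ordinal.{u} → Set A := fun o => opsClosure ops {a | a ∈ E ∧ pos a ≤ o}
    have hBE : ∀ o, B o ⊆ E := fun o => opsClosure_subset hE fun _ h => h.1
    have hBcl : ∀ o, OpsClosed ops (B o) := fun o => opsClosed_opsClosure _ _
    have hBmono : Monotone B := fun o o' h => opsClosure_mono _ fun a ha => ⟨ha.1, ha.2.trans h⟩
    have hBpos : ∀ a ∈ E, a ∈ B (pos a) := fun a ha => subset_opsClosure _ _ ⟨ha, le_rfl⟩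
    have hBcard : ∀ o < (#E).ord, #(B o) < #E := by
      intro o ho
      refine (mk_opsClosure_le _ _).trans_lt (max_lt hunc ?_)
      have hs : Order.succ o < (#E).ord := (isSuccLimit_ord hunc.le).succ_lt ho
      refine lt_of_le_of_lt ?_ (lt_ord.1 hs)
      rw [← lift_le.{u + 1}, ← mk_Iio_ordinal,
        ← mk_image_eq_of_injOn_lift pos _ (hpos_inj.mono fun a ha => ha.1), lift_id'.{u, u+1}]
      exact mk_le_mk_of_subset (by rintro _ ⟨a, ha, rfl⟩; exact Order.lt_succ_of_le ha.2)
    choose! rk idx hinj hfin using fun o (ho : o < (#E).ord) => ih _ (hBcard o ho) (hBcl o) rfl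
    let fst : A → Ordinal.{u} := fun a => sInf {o | a ∈ B o}
    have hfst_mem : ∀ a ∈ E, a ∈ B (fst a) := fun a ha =>
      csInf_mem (s := {o | a ∈ B o}) ⟨pos a, hBpos a ha⟩
    have hfst_le : ∀ a o, a ∈ B o → fst a ≤ o := fun a o h => csInf_le' h
    have hfst_lt : ∀ a ∈ E, fst a < (#E).ord := fun a ha =>
      (hfst_le a _ (hBpos a ha)).trans_lt (hpos_lt a ha)
    -- `M` exceeds every inner rank used, so `M * fst a + rk (fst a) a` encodes the lexicographic
    -- pair, recovered by quotient and remainder.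
    let M : Ordinal.{u} := Order.succ (⨆ a : A, rk (fst a) a)
    have hM : ∀ a, rk (fst a) a < M := fun a =>
      Order.lt_succ_of_le (Ordinal.le_iSup (fun a : A => rk (fst a) a) a)
    have hM0 : M ≠ 0 := Order.succ_ne_bot _
    have hdiv : ∀ a, (M * fst a + rk (fst a) a) / M = fst a := fun a => by
      rw [Ordinal.mul_add_div _ hM0, Ordinal.div_eq_zero_of_lt (hM a), add_zero]
    have hmod : ∀ a, (M * fst a + rk (fst a) a) % M = rk (fst a) a := fun a => by
      rw [Ordinal.mul_add_mod_self, Ordinal.mod_eq_of_lt (hM a)]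
    refine ⟨fun a => M * fst a + rk (fst a) a, fun a => idx (fst a) a, ?_, fun ξ => ?_⟩
    · intro a ha b hb h h'
      beta_reduce at h h'
      have h1 : fst a = fst b := by rw [← hdiv a, ← hdiv b, h]
      have h2 : rk (fst a) a = rk (fst a) b := by
        conv_rhs => rw [h1]
        rw [← hmod a, ← hmod b, h]
      rw [← h1] at h'
      exact hinj _ (hfst_lt a ha) a (hfst_mem a ha) b (h1 ▸ hfst_mem b hb) h2 h'
    · set α := ξ / M with hα
      set ρ := ξ % M with hρ
      have hξ : M * α + ρ = ξ := Ordinal.div_add_mod _ _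
      have hρM : ρ < M := Ordinal.mod_lt _ hM0
      have hiff : ∀ a, M * fst a + rk (fst a) a < ξ ↔
          fst a < α ∨ fst a = α ∧ rk α a < ρ := by
        intro a
        have key : ∀ {x y s t : Ordinal.{u}}, s < M → x < y → M * x + s < M * y + t := by
          intro x y s t hs hxy
          calc M * x + s < M * x + M := by gcongr
            _ = M * Order.succ x := (Ordinal.mul_succ _ _).symm
            _ ≤ M * y := by gcongr; exact Order.succ_le_of_lt hxy
            _ ≤ M * y + t := le_self_add
        rw [← hξ]
        rcases lt_trichotomy (fst a) α with h | h | h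
        · simp [h, key (hM a) h]
        · simp [h]
        · simp [h.not_gt, h.ne', (key hρM h).le]
      -- The part of the segment with `fst a < α` is one closed set, a directed union. What remains
      -- comes from `B α` by induction; elements of `B α` that entered earlier are merely counted
      -- twice.
      have hlow : ∃ F : Set (Set A), F.Finite ∧ (∀ G ∈ F, OpsClosed ops G) ∧
          {a | a ∈ E ∧ fst a < α} = ⋃₀ F := by
        rcases eq_or_ne α 0 with h0 | h0
        · exact ⟨∅, by simp [h0]⟩
        · refine ⟨{⋃ o : Set.Iio α, B o}, by simp, ?_, ?_⟩
          · have : Nonempty (Set.Iio α) := ⟨⟨0, pos_iff_ne_zero.2 h0⟩⟩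
            rintro _ rfl
            exact OpsClosed.iUnion (directed_of_isDirected_le fun o o' h => hBmono h)
              fun o => hBcl o
          · ext a
            simp only [Set.mem_ofPred_eq, Set.sUnion_singleton, Set.mem_iUnion, Subtype.exists,
              Set.mem_Iio, exists_prop]
            exact ⟨fun h => ⟨fst a, h.2, hfst_mem a h.1⟩,
              fun ⟨o, ho, h⟩ => ⟨hBE o h, (hfst_le a o h).trans_lt ho⟩⟩
      obtain ⟨F, hF, hFc, hFe⟩ := hlow
      rcases lt_or_ge α (#E).ord with hlt | hge
      · obtain ⟨F', hF', hFc', hFe'⟩ := hfin α hlt ρ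
        refine ⟨F ∪ F', hF.union hF', ?_, ?_⟩
        · rintro G (h | h)
          exacts [hFc G h, hFc' G h]
        · rw [Set.sUnion_union, ← hFe, ← hFe']
          ext a
          simp only [hiff, Set.mem_ofPred_eq, Set.mem_union]
          constructor
          · rintro ⟨ha, h | ⟨h, h'⟩⟩
            exacts [Or.inl ⟨ha, h⟩, Or.inr ⟨h ▸ hfst_mem a ha, h'⟩]
          · rintro (⟨ha, h⟩ | ⟨ha, h⟩)
            · exact ⟨ha, Or.inl h⟩
            · refine ⟨hBE _ ha, ?_⟩
              rcases (hfst_le a α ha).lt_or_eq with h' | h'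
              exacts [Or.inl h', Or.inr ⟨h', h⟩]
      · refine ⟨{E}, by simp, by simpa using hE, ?_⟩
        ext a
        simp only [hiff, Set.mem_ofPred_eq, Set.sUnion_singleton, and_iff_left_iff_imp]
        exact fun ha => Or.inl ((hfst_lt a ha).trans_le hge)

end FinitaryClosure

/-! ### Linked families, projections and rank-closed extensions. -/

section LinkedFamilies

variable {K : Type*} {A : Type u}

/-- A subfamily `E` of the family `O` of open sets is regular if it is closed under binary unions
and every nonempty open set `G` has a member of `E` below its upper projection to `E`: all members
of `E` that meet it meet `G`. -/
structure IsRegularSubfamily [TopologicalSpace K] (O : A → Set K) (E : Set A) : Prop where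
  exists_proj : ∀ G, IsOpen G → G.Nonempty →
    ∃ h ∈ E, ∀ b ∈ E, (O b ∩ O h).Nonempty → (O b ∩ G).Nonempty
  exists_union : ∀ a ∈ E, ∀ b ∈ E, ∃ c ∈ E, O c = O a ∪ O b

theorem exists_eq_biUnion {O : A → Set K} {E : Set A}
    (hE : ∀ a ∈ E, ∀ b ∈ E, ∃ c ∈ E, O c = O a ∪ O b) {ι : Type*} {s : Finset ι}
    (hs : s.Nonempty) (f : ι → A) (hf : ∀ i ∈ s, f i ∈ E) :
    ∃ c ∈ E, O c = ⋃ i ∈ s, O (f i) := by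
  classical
  induction hs using Finset.Nonempty.cons_induction with
  | singleton i => exact ⟨f i, hf i (by simp), by simp⟩
  | cons i s hi hs ih =>
    obtain ⟨c, hc, hce⟩ := ih fun j hj => hf j (by simp [hj])
    obtain ⟨d, hd, hde⟩ := hE (f i) (hf i (by simp)) c hc
    exact ⟨d, hd, by rw [hde, hce]; simp⟩

/-- A family of nonempty open sets, a `π`-base closed under binary unions, ordered in countable
blocks such that the members before any given block form a finite union of regular subfamilies. -/
structure IsRankedFamily [TopologicalSpace K] (O : A → Set K) (rank : A → Ordinal.{u})
    (idx : A → ℕ) : Prop where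
  isOpen : ∀ a, IsOpen (O a)
  nonempty : ∀ a, (O a).Nonempty
  exists_subset : ∀ G, IsOpen G → G.Nonempty → ∃ a, O a ⊆ G
  exists_union : ∀ a b, ∃ c, O c = O a ∪ O b
  injective : ∀ a b, rank a = rank b → idx a = idx b → a = b
  initial : ∀ ξ, ∃ F : Set (Set A), F.Finite ∧ (∀ E ∈ F, IsRegularSubfamily O E) ∧
    {a | rank a < ξ} = ⋃₀ F

/-- A family of sets is linked if its members meet pairwise. -/
def IsLinked (O : A → Set K) (p : Set A) : Prop :=
  ∀ a ∈ p, ∀ b ∈ p, (O a ∩ O b).Nonempty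

/-- Each set of lower rank that misses a member `O v` of the family misses a member of the family
of rank less than that of `v`. -/
def IsRankClosed (O : A → Set K) (rank : A → Ordinal.{u}) (p : Set A) : Prop :=
  ∀ v ∈ p, ∀ b, rank b < rank v → (∀ h ∈ p, rank h < rank v → (O b ∩ O h).Nonempty) →
    (O b ∩ O v).Nonempty

theorem IsLinked.mono {O : A → Set K} {p q : Set A} (hq : IsLinked O q) (h : p ⊆ q) :
    IsLinked O p := fun a ha b hb => hq a (h ha) b (h hb)

theorem IsRankClosed.inter_rank_lt {O : A → Set K} {rank : A → Ordinal.{u}} {p : Set A}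
    (hp : IsRankClosed O rank p) (ξ : Ordinal.{u}) :
    IsRankClosed O rank {a | a ∈ p ∧ rank a < ξ} := fun v hv b hb hall =>
  hp v hv.1 b hb fun h hh hlt => hall h ⟨hh, hlt.trans hv.2⟩ hlt

/-- Two linked rank-closed families that agree on their common blocks form a linked family. -/
theorem IsRankClosed.inter_nonempty {O : A → Set K} {rank : A → Ordinal.{u}} {p q : Set A}
    (hp : IsRankClosed O rank p) (hq : IsRankClosed O rank q) (hql : IsLinked O q)
    (hpq : ∀ a ∈ p, ∀ b ∈ q, rank a = rank b → a ∈ q) :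
    ∀ a ∈ p, ∀ b ∈ q, (O a ∩ O b).Nonempty := by
  -- Induction on the larger rank: rank-closedness at the higher member reduces to pairs with
  -- smaller maximum, and in equal ranks agreement puts both members in `q`.
  suffices H : ∀ ζ, ∀ a ∈ p, ∀ b ∈ q, max (rank a) (rank b) = ζ → (O a ∩ O b).Nonempty from
    fun a ha b hb => H _ a ha b hb rfl
  intro ζ
  induction ζ using WellFoundedLT.induction with
  | _ ζ ih =>
  rintro a ha b hb rfl
  rcases lt_trichotomy (rank a) (rank b) with h | h | h
  · exact hq b hb a h fun c hc hlt => ih _ (by simp [h, hlt]) a ha c hc rfl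
  · exact hql a (hpq a ha b hb h) b hb
  · rw [Set.inter_comm]
    refine hp a ha b h fun c hc hlt => ?_
    rw [Set.inter_comm]
    exact ih _ (by simp [h, hlt]) c hc b hb rfl

/-- A member of a linked family can be projected to a regular subfamily, keeping the family
linked, and keeping its intersection nonempty in a given open set. -/
theorem IsRegularSubfamily.exists_insert [TopologicalSpace K] {O : A → Set K}
    (hO : ∀ a, IsOpen (O a)) (hn : ∀ a, (O a).Nonempty)
    {E : Set A} (hE : IsRegularSubfamily O E) {p : Finset A}
    (hp : IsLinked O (p : Set A)) {G : Set K} (hG : IsOpen G) {v : A} (hv : v ∈ p) :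
    ∃ h ∈ E, (∀ b ∈ E, (O b ∩ O h).Nonempty → (O b ∩ O v).Nonempty) ∧
      IsLinked O (insert h (p : Set A)) ∧
      ((G ∩ ⋂ a ∈ p, O a).Nonempty → (G ∩ (O h ∩ ⋂ a ∈ p, O a)).Nonempty) := by
  classical
  -- Finitely many nonempty open subsets of `O v` that the projection must meet. `h` is the union of
  -- their projections; the slot `none` preserves the common intersection, with `O v` as a harmless
  -- default.
  let D : Option A → Set K := fun o => o.elim
    (if (G ∩ ⋂ a ∈ p, O a).Nonempty then G ∩ ⋂ a ∈ p, O a else O v) fun a => O v ∩ O a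
  have hpo : IsOpen (⋂ a ∈ p, O a) := isOpen_biInter_finset fun a _ => hO a
  have hDo : ∀ o, IsOpen (D o) := by
    rintro (_ | a)
    · simp only [D, Option.elim]
      split_ifs
      exacts [hG.inter hpo, hO v]
    · exact (hO v).inter (hO a)
  have hDn : ∀ o ∈ Finset.insertNone p, (D o).Nonempty := by
    rintro (_ | a) ha
    · simp only [D, Option.elim]
      split_ifs with h
      exacts [h, by simpa using hp v hv v hv]
    · exact hp v hv a (by simpa using ha)
  have hDv : ∀ o, D o ⊆ O v := by
    rintro (_ | a)
    · simp only [D, Option.elim]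
      split_ifs
      exacts [fun x hx => Set.mem_iInter₂.1 hx.2 v hv, subset_rfl]
    · exact Set.inter_subset_left
  have : Nonempty A := ⟨v⟩
  choose! f hfE hf using fun o ho => hE.exists_proj (D o) (hDo o) (hDn o ho)
  obtain ⟨h, hh, hhe⟩ := exists_eq_biUnion hE.exists_union
    (s := Finset.insertNone p) ⟨none, by simp⟩ f hfE
  have hmeet : ∀ b ∈ E, (O b ∩ O h).Nonempty → (O b ∩ O v).Nonempty := by
    rintro b hb ⟨x, hxb, hx⟩
    rw [hhe] at hx
    simp only [Set.mem_iUnion, exists_prop] at hx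
    obtain ⟨o, ho, hx⟩ := hx
    exact (hf o ho b hb ⟨x, hxb, hx⟩).mono (Set.inter_subset_inter_right _ (hDv o))
  have hsub : ∀ o ∈ Finset.insertNone p, (O h ∩ D o).Nonempty := fun o ho =>
    (hf o ho _ (hfE o ho) (by simpa using hn _)).mono
      (Set.inter_subset_inter_left _ (hhe ▸ Set.subset_biUnion_of_mem (u := fun o => O (f o)) ho))
  have hlink : ∀ a ∈ p, (O h ∩ O a).Nonempty := fun a ha =>
    (hsub (some a) (by simpa using ha)).mono
      (Set.inter_subset_inter_right _ Set.inter_subset_right)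
  refine ⟨h, hh, hmeet, ?_, fun hne => ?_⟩
  · rintro a (rfl | ha) b (rfl | hb)
    · simpa using hn _
    · exact hlink b hb
    · rw [Set.inter_comm]
      exact hlink a ha
    · exact hp a ha b hb
  · have := hsub none (by simp)
    simp only [D, Option.elim, if_pos hne] at this
    rwa [Set.inter_left_comm]

theorem IsLinked.exists_projections [TopologicalSpace K] {O : A → Set K}
    (hO : ∀ a, IsOpen (O a)) (hn : ∀ a, (O a).Nonempty) {p : Finset A}
    (hp : IsLinked O (p : Set A)) {G : Set K} (hG : IsOpen G) (s : Finset (Set A × A))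
    (hs : ∀ x ∈ s, IsRegularSubfamily O x.1 ∧ x.2 ∈ p) :
    ∃ q : Finset A, p ⊆ q ∧ IsLinked O (q : Set A) ∧ (∀ a ∈ q, a ∈ p ∨ ∃ x ∈ s, a ∈ x.1) ∧
      ((G ∩ ⋂ a ∈ p, O a).Nonempty → (G ∩ ⋂ a ∈ q, O a).Nonempty) ∧
      ∀ x ∈ s, ∃ h ∈ q, h ∈ x.1 ∧ ∀ b ∈ x.1, (O b ∩ O h).Nonempty → (O b ∩ O x.2).Nonempty := by
  classical
  induction s using Finset.induction_on with
  | empty => exact ⟨p, subset_rfl, hp, fun a ha => Or.inl ha, id, by simp⟩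
  | insert x s hx ih =>
    obtain ⟨q, hpq, hq, hqs, hqG, hqp⟩ := ih fun y hy => hs y (by simp [hy])
    obtain ⟨hreg, hxp⟩ := hs x (by simp)
    obtain ⟨h, hh, hmeet, hl, hc⟩ := hreg.exists_insert hO hn hq hG (hpq hxp)
    refine ⟨insert h q, hpq.trans (Finset.subset_insert _ _), by simpa using hl, ?_, ?_, ?_⟩
    · intro a ha
      rcases Finset.mem_insert.1 ha with rfl | ha
      · exact Or.inr ⟨x, by simp, hh⟩
      · rcases hqs a ha with h | ⟨y, hy, h⟩
        exacts [Or.inl h, Or.inr ⟨y, by simp [hy], h⟩]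
    · intro h
      simpa using hc (hqG h)
    · intro y hy
      rcases Finset.mem_insert.1 hy with rfl | hy
      · exact ⟨h, by simp, hh, hmeet⟩
      · obtain ⟨h', h1, h2⟩ := hqp y hy
        exact ⟨h', by simp [h1], h2⟩

/-- Every finite linked family extends to a finite linked rank-closed one, without raising the
ranks and keeping its intersection nonempty in a given open set. -/
theorem IsRankedFamily.exists_isRankClosed [TopologicalSpace K] {O : A → Set K}
    {rank : A → Ordinal.{u}} {idx : A → ℕ} (hO : IsRankedFamily O rank idx) (ξ : Ordinal.{u}) :
    ∀ (p : Finset A), IsLinked O (p : Set A) → (∀ a ∈ p, rank a < ξ) → ∀ G, IsOpen G →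
    ∃ q : Finset A, p ⊆ q ∧ IsLinked O (q : Set A) ∧ IsRankClosed O rank (q : Set A) ∧
      (∀ a ∈ q, rank a < ξ) ∧ ((G ∩ ⋂ a ∈ p, O a).Nonempty → (G ∩ ⋂ a ∈ q, O a).Nonempty) := by
  classical
  induction ξ using WellFoundedLT.induction with
  | _ ξ ih =>
  intro p hp hpξ G hG
  rcases p.eq_empty_or_nonempty with rfl | hne
  · exact ⟨∅, by simp, hp, by simp [IsRankClosed], by simp, id⟩
  obtain ⟨m, hm, hmax⟩ := p.exists_max_image rank hne
  obtain ⟨F, hF, hFreg, hFe⟩ := hO.initial (rank m)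
  -- Each member of the top block is projected to each of the finitely many regular subfamilies
  -- covering the lower ranks; then induction treats everything below the block.
  set t := p.filter (fun a => rank a = rank m) with ht
  obtain ⟨p', hpp', hp', hp'F, hp'G, hproj⟩ := hp.exists_projections hO.isOpen hO.nonempty hG
    (hF.toFinset ×ˢ t) (by
      intro x hx
      simp only [Finset.mem_product, Set.Finite.mem_toFinset, ht, Finset.mem_filter] at hx
      exact ⟨hFreg _ hx.1, hx.2.1⟩)
  have hF_lt : ∀ a, rank a < rank m ↔ ∃ E ∈ F, a ∈ E := fun a => by
    simpa using Set.ext_iff.1 hFe a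
  set low := p'.filter (fun a => rank a < rank m) with hlow
  have hcover : ∀ a ∈ p', a ∈ low ∨ a ∈ t := by
    intro a ha
    rcases hp'F a ha with h | ⟨x, hx, h⟩
    · rcases (hmax a h).lt_or_eq with h' | h'
      · exact Or.inl (by simp [hlow, ha, h'])
      · exact Or.inr (by simp [ht, h, h'])
    · simp only [Finset.mem_product, Set.Finite.mem_toFinset] at hx
      exact Or.inl (by simp only [hlow, Finset.mem_filter]; exact ⟨ha, (hF_lt a).2 ⟨_, hx.1, h⟩⟩)
  have htp : ∀ a ∈ t, a ∈ p ∧ rank a = rank m := fun a ha => by simpa [ht] using ha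
  have hto : IsOpen (⋂ a ∈ t, O a) := isOpen_biInter_finset fun a _ => hO.isOpen a
  obtain ⟨q, hlq, hq, hqc, hqξ, hqG⟩ := ih (rank m) (hpξ m hm) low
    (hp'.mono (Finset.coe_subset.2 (Finset.filter_subset _ _))) (by simp [hlow])
    (G ∩ ⋂ a ∈ t, O a) (hG.inter hto)
  -- Such a `b` lies in some `E ∈ F`, and `q` contains a projection of `v` to `E`. This also links
  -- `t` to the members added by the recursion.
  have hdown : ∀ v ∈ t, ∀ b, rank b < rank m →
      (∀ h ∈ q, (O b ∩ O h).Nonempty) → (O b ∩ O v).Nonempty := by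
    intro v hv b hb hall
    obtain ⟨E, hE, hbE⟩ := (hF_lt b).1 hb
    obtain ⟨h, hh, hhE, hmeet⟩ := hproj (E, v) (by simp [hE, hv])
    refine hmeet b hbE (hall h (hlq ?_))
    simp only [hlow, Finset.mem_filter]
    exact ⟨hh, (hF_lt h).2 ⟨E, hE, hhE⟩⟩
  refine ⟨q ∪ t, ?_, ?_, ?_, ?_, ?_⟩
  · intro a ha
    rcases hcover a (hpp' ha) with h | h
    exacts [Finset.mem_union_left _ (hlq h), Finset.mem_union_right _ h]
  · have hqt : ∀ a ∈ q, ∀ b ∈ t, (O a ∩ O b).Nonempty := fun a ha b hb =>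
      hdown b hb a (hqξ a ha) fun h hh => hq a ha h hh
    intro a ha b hb
    rcases Finset.mem_union.1 ha with ha | ha <;> rcases Finset.mem_union.1 hb with hb | hb
    · exact hq a ha b hb
    · exact hqt a ha b hb
    · rw [Set.inter_comm]
      exact hqt b hb a ha
    · exact hp a (htp a ha).1 b (htp b hb).1
  · intro v hv b hb hall
    rcases Finset.mem_union.1 hv with hv | hv
    · exact hqc v hv b hb fun h hh hlt => hall h (Finset.mem_union_left _ hh) hlt
    · rw [(htp v hv).2] at hb
      refine hdown v hv b hb fun h hh => hall h (Finset.mem_union_left _ hh) ?_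
      rw [(htp v hv).2]
      exact hqξ h hh
  · intro a ha
    rcases Finset.mem_union.1 ha with ha | ha
    exacts [(hqξ a ha).trans (hpξ m hm), hpξ a (htp a ha).1]
  · intro h
    have h1 := hp'G h
    obtain ⟨x, hx⟩ := hqG (by
      refine h1.mono fun x hx => ?_
      simp only [Set.mem_inter_iff, Set.mem_iInter] at hx ⊢
      exact ⟨⟨hx.1, fun a ha => hx.2 a (hpp' (htp a ha).1)⟩,
        fun a ha => hx.2 a (Finset.mem_filter.1 ha).1⟩)
    refine ⟨x, ?_⟩
    simp only [Set.mem_inter_iff, Set.mem_iInter, Finset.mem_union] at hx ⊢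
    exact ⟨hx.1.1, fun a ha => ha.elim (hx.2 a) (hx.1.2 a)⟩

end LinkedFamilies

/-! ### Good families and their ultrafilter limits. -/

section GoodFamilies

variable {K : Type*} [TopologicalSpace K] {A : Type u}

/-- A finite linked rank-closed family is good for `W` if every nonempty open set that misses `W`
misses a member of the family. -/
structure IsGood (O : A → Set K) (rank : A → Ordinal.{u}) (W : Set K) (p : Finset A) : Prop where
  isLinked : IsLinked O (p : Set A)
  isRankClosed : IsRankClosed O rank (p : Set A)
  meets : ∀ T, IsOpen T → (∀ v ∈ p, (T ∩ O v).Nonempty) → T.Nonempty → (T ∩ W).Nonempty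

theorem IsGood.mono {O : A → Set K} {rank : A → Ordinal.{u}} {W W' : Set K} {p : Finset A}
    (hp : IsGood O rank W p) (h : W ⊆ W') : IsGood O rank W' p :=
  ⟨hp.isLinked, hp.isRankClosed, fun T hT hall hne =>
    (hp.meets T hT hall hne).mono (Set.inter_subset_inter_right _ h)⟩

theorem Ultrafilter.finite_setOf_eventually_mem_finset {ι : Type*} (𝒰 : Ultrafilter ι) {k : ℕ}
    {p : ι → Finset A} (hcard : ∀ᶠ i in 𝒰, (p i).card ≤ k) :
    {v | ∀ᶠ i in 𝒰, v ∈ p i}.Finite := by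
  by_contra hinf
  obtain ⟨s, hs, hsk⟩ := Set.Infinite.exists_subset_card_eq hinf (k + 1)
  have h1 : ∀ᶠ i in 𝒰, ∀ v ∈ s, v ∈ p i :=
    (Filter.eventually_all_finset s).2 fun v hv => hs hv
  obtain ⟨i, hi, hi'⟩ := (h1.and hcard).exists
  have := Finset.card_le_card (show s ⊆ p i from hi)
  omega

/-- The limit, along an ultrafilter, of families of bounded size which are good for `W i`
is good for the limit of the sets `W i`. -/
theorem IsRankedFamily.exists_isGood_limit {O : A → Set K} {rank : A → Ordinal.{u}}
    {idx : A → ℕ} (hO : IsRankedFamily O rank idx) {ι : Type*} (𝒰 : Ultrafilter ι) {k : ℕ}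
    {W : ι → Set K} {W₀ : Set K} {p : ι → Finset A}
    (hp : ∀ᶠ i in 𝒰, IsGood O rank (W i) (p i)) (hcard : ∀ᶠ i in 𝒰, (p i).card ≤ k)
    (hidx : ∀ᶠ i in 𝒰, ∀ v ∈ p i, idx v ≤ k)
    (hW : ∀ T, IsOpen T → T.Nonempty → Disjoint T W₀ →
      ∃ T' ⊆ T, IsOpen T' ∧ T'.Nonempty ∧ ∀ᶠ i in 𝒰, Disjoint T' (W i)) :
    ∃ R : Finset A, IsGood O rank W₀ R ∧ ∀ᶠ i in 𝒰, R ⊆ p i := by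
  classical
  obtain ⟨R, hR⟩ := (𝒰.finite_setOf_eventually_mem_finset hcard).exists_finset
  have hRp : ∀ᶠ i in 𝒰, R ⊆ p i :=
    (Filter.eventually_all_finset R).2 fun v hv => (hR v).1 hv
  -- Only finitely many members of a block have index at most `k`, and each one outside `R` is
  -- eventually absent from `p i`.
  have hagree : ∀ b, ∀ᶠ i in 𝒰, ∀ a ∈ p i, rank a = rank b → a ∈ R := by
    intro b
    have hfin : {a | (rank a = rank b ∧ idx a ≤ k) ∧ a ∉ R}.Finite := by
      refine Set.Finite.of_finite_image ((Set.finite_Iic k).subset ?_)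
        (f := idx) fun a ha b hb h => hO.injective a b (ha.1.1.trans hb.1.1.symm) h
      rintro _ ⟨a, ha, rfl⟩
      exact ha.1.2
    have h : ∀ᶠ i in 𝒰, ∀ a ∈ {a | (rank a = rank b ∧ idx a ≤ k) ∧ a ∉ R}, a ∉ p i :=
      (Filter.eventually_all_finite hfin).2 fun a ha =>
        Ultrafilter.eventually_not.2 fun h => ha.2 ((hR a).2 h)
    filter_upwards [h, hidx] with i hi hi' a ha hab
    by_contra haR
    exact hi a ⟨⟨hab, hi' a ha⟩, haR⟩ ha
  have hcompat : ∀ (ξ : Ordinal.{u}) (q : Finset A), IsLinked O (q : Set A) →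
      IsRankClosed O rank (q : Set A) → (∀ b ∈ q, rank b < ξ) →
      (∀ a ∈ R, rank a < ξ → a ∈ q) →
      ∀ᶠ i in 𝒰, ∀ a ∈ p i, rank a < ξ → ∀ b ∈ q, (O a ∩ O b).Nonempty := by
    intro ξ q hq hqc hqξ hRq
    have h : ∀ᶠ i in 𝒰, ∀ b ∈ q, ∀ a ∈ p i, rank a = rank b → a ∈ R :=
      (Filter.eventually_all_finset q).2 fun b _ => hagree b
    filter_upwards [h, hp] with i hi hpi a ha haξ b hb
    exact (hpi.isRankClosed.inter_rank_lt ξ).inter_nonempty hqc hq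
      (fun a ha b hb hab => hRq a (hi b hb a ha.1 hab) ha.2) a ⟨ha, haξ⟩ b hb
  have hlink : IsLinked O (R : Set A) := by
    obtain ⟨i, hi, hpi⟩ := (hRp.and hp).exists
    exact hpi.isLinked.mono (Finset.coe_subset.2 hi)
  have hinsert : ∀ (t : A) (s : Finset A), s ⊆ R → (∀ h ∈ s, (O t ∩ O h).Nonempty) →
      IsLinked O ((insert t s : Finset A) : Set A) := by
    intro t s hs ht a ha b hb
    rcases Finset.mem_insert.1 ha with rfl | ha <;> rcases Finset.mem_insert.1 hb with rfl | hb
    · simpa using hO.nonempty _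
    · exact ht b hb
    · rw [Set.inter_comm]
      exact ht _ ‹_›
    · exact hlink a (hs ha) b (hs hb)
  refine ⟨R, ⟨hlink, ?_, ?_⟩, hRp⟩
  · intro v hv b hb hall
    -- A rank-closed family containing `b` and the part of `R` below `v` is eventually linked to the
    -- part of `p i` below `v`, so rank-closedness of `p i` at `v` applies to `b`.
    obtain ⟨q, hsq, hq, hqc, hqξ, -⟩ := hO.exists_isRankClosed (rank v)
      (insert b (R.filter fun a => rank a < rank v))
      (hinsert b _ (Finset.filter_subset _ _) fun h hh =>
        hall h (Finset.mem_filter.1 hh).1 (Finset.mem_filter.1 hh).2)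
      (by simp [hb]) Set.univ isOpen_univ
    obtain ⟨i, hi, hpi, hRi⟩ := ((hcompat (rank v) q hq hqc hqξ fun a ha hav =>
      hsq (by simp [ha, hav])).and (hp.and hRp)).exists
    refine hpi.isRankClosed v (hRi hv) b hb fun h hh hlt => ?_
    rw [Set.inter_comm]
    exact hi h hh hlt b (hsq (by simp))
  · intro T hT hall hTne
    by_contra hdis
    rw [Set.not_nonempty_iff_eq_empty, ← Set.disjoint_iff_inter_eq_empty] at hdis
    -- `T` is replaced by a finite union `O t` that still meets all of `R` and eventually misses `W
    -- i`; the slot `none` keeps the union nonempty when `R` is empty. Then `t` eventually meets all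
    -- of `p i`, against goodness.
    have hsmall : ∀ v : Option A, v ∈ Finset.insertNone R → ∃ a, O a ⊆ T ∩ v.elim Set.univ O ∧
        ∀ᶠ i in 𝒰, Disjoint (O a) (W i) := by
      intro v hv
      have hG : IsOpen (T ∩ v.elim Set.univ O) ∧ (T ∩ v.elim Set.univ O).Nonempty := by
        cases v with
        | none => simpa using ⟨hT, hTne⟩
        | some v => exact ⟨hT.inter (hO.isOpen v), hall v (by simpa using hv)⟩
      obtain ⟨T', hT'T, hT', hne, hT'W⟩ := hW _ hG.1 hG.2 (hdis.mono_left Set.inter_subset_left)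
      obtain ⟨a, ha⟩ := hO.exists_subset T' hT' hne
      exact ⟨a, ha.trans hT'T, hT'W.mono fun i hi => hi.mono_left ha⟩
    obtain ⟨a₀, -⟩ := hO.exists_subset T hT hTne
    have : Nonempty A := ⟨a₀⟩
    choose! f hf hfW using hsmall
    obtain ⟨t, -, ht⟩ := exists_eq_biUnion (E := Set.univ)
      (fun a _ b _ => (hO.exists_union a b).imp fun c hc => ⟨Set.mem_univ c, hc⟩)
      (s := Finset.insertNone R) ⟨none, by simp⟩ f fun _ _ => Set.mem_univ _
    have htR : ∀ v ∈ R, (O t ∩ O v).Nonempty := by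
      intro v hv
      have hv' : some v ∈ Finset.insertNone R := by simpa using hv
      obtain ⟨x, hx⟩ := hO.nonempty (f (some v))
      exact ⟨x, ht ▸ Set.mem_biUnion (t := fun o => O (f o)) hv' hx, (hf _ hv' hx).2⟩
    have htW : ∀ᶠ i in 𝒰, Disjoint (O t) (W i) := by
      filter_upwards [(Filter.eventually_all_finset (Finset.insertNone R)).2 hfW] with i hi
      rw [ht]
      simpa only [Set.disjoint_iUnion_left] using hi
    let ξ : Ordinal.{u} := Order.succ (⨆ a, rank a)
    have hξ : ∀ a, rank a < ξ := fun a => Order.lt_succ_of_le (Ordinal.le_iSup rank a)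
    obtain ⟨q, hsq, hq, hqc, hqξ, -⟩ := hO.exists_isRankClosed ξ (insert t R)
      (hinsert t R subset_rfl htR) (fun a _ => hξ a) Set.univ isOpen_univ
    obtain ⟨i, hi, hpi, hti⟩ := ((hcompat ξ q hq hqc hqξ fun a ha _ =>
      hsq (by simp [ha])).and (hp.and htW)).exists
    refine Set.not_disjoint_iff_nonempty_inter.2 (hpi.meets (O t) (hO.isOpen t) (fun v hv => ?_)
      (hO.nonempty t)) hti
    rw [Set.inter_comm]
    exact hi v hv (hξ v) t (hsq (by simp))

end GoodFamilies

/-! ### The supremum of weights as a quasi `κ`-metric. -/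

section GoodSup

open Filter Topology

variable {K : Type*} {A : Type u}

/-- The weight of a finite family at a point: a product of bump functions, scaled down so that
families of weight bounded from below have bounded size and bounded indices. -/
noncomputable def familyWeight (ψ : A → K → ℝ) (idx : A → ℕ) (p : Finset A) (x : K) : ℝ :=
  ∏ v ∈ p, (1 / 2 : ℝ) ^ (idx v + 1) * ψ v x

/-- The supremum of the weights of the families that are good for `W`. -/
noncomputable def goodSup [TopologicalSpace K] (O : A → Set K) (rank : A → Ordinal.{u})
    (ψ : A → K → ℝ) (idx : A → ℕ) (W : Set K) (x : K) : ℝ :=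
  ⨆ p : {p : Finset A // IsGood O rank W p}, familyWeight ψ idx p x

section Weight

variable {ψ : A → K → ℝ} {idx : A → ℕ}

theorem familyWeight_nonneg (h0 : ∀ a x, 0 ≤ ψ a x)
    (p : Finset A) (x : K) : 0 ≤ familyWeight ψ idx p x :=
  Finset.prod_nonneg fun v _ => mul_nonneg (by positivity) (h0 v x)

theorem familyWeight_factor_le_half (h1 : ∀ a x, ψ a x ≤ 1)
    (v : A) (x : K) :
    (1 / 2 : ℝ) ^ (idx v + 1) * ψ v x ≤ 1 / 2 :=
  calc (1 / 2 : ℝ) ^ (idx v + 1) * ψ v x ≤ (1 / 2 : ℝ) ^ (idx v + 1) * 1 := by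
        gcongr; exact h1 v x
    _ ≤ (1 / 2 : ℝ) ^ 1 * 1 := by
        gcongr ?_ * 1
        exact pow_le_pow_of_le_one (by norm_num) (by norm_num) (by omega)
    _ = 1 / 2 := by norm_num

theorem familyWeight_anti (h0 : ∀ a x, 0 ≤ ψ a x)
    (h1 : ∀ a x, ψ a x ≤ 1) {p q : Finset A} (h : p ⊆ q) (x : K) :
    familyWeight ψ idx q x ≤ familyWeight ψ idx p x := by
  classical
  rw [familyWeight, ← Finset.prod_sdiff h]
  exact mul_le_of_le_one_left (familyWeight_nonneg h0 p x)
    (Finset.prod_le_one (fun v _ => mul_nonneg (by positivity) (h0 v x))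
      fun v _ => (familyWeight_factor_le_half h1 v x).trans (by norm_num))

theorem familyWeight_le_one (h0 : ∀ a x, 0 ≤ ψ a x)
    (h1 : ∀ a x, ψ a x ≤ 1) (p : Finset A) (x : K) : familyWeight ψ idx p x ≤ 1 := by
  simpa [familyWeight] using familyWeight_anti (idx := idx) h0 h1 (Finset.empty_subset p) x

theorem familyWeight_le_pow_card (h0 : ∀ a x, 0 ≤ ψ a x)
    (h1 : ∀ a x, ψ a x ≤ 1) (p : Finset A) (x : K) :
    familyWeight ψ idx p x ≤ (1 / 2 : ℝ) ^ p.card := by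
  rw [← Finset.prod_const]
  exact Finset.prod_le_prod (fun v _ => mul_nonneg (by positivity) (h0 v x))
    fun v _ => familyWeight_factor_le_half h1 v x

theorem familyWeight_le_pow_idx (h0 : ∀ a x, 0 ≤ ψ a x)
    (h1 : ∀ a x, ψ a x ≤ 1) {p : Finset A} {v : A} (hv : v ∈ p) (x : K) :
    familyWeight ψ idx p x ≤ (1 / 2 : ℝ) ^ idx v := by
  refine (familyWeight_anti h0 h1 (Finset.singleton_subset_iff.2 hv) x).trans ?_
  rw [familyWeight, Finset.prod_singleton]
  calc (1 / 2 : ℝ) ^ (idx v + 1) * ψ v x ≤ (1 / 2 : ℝ) ^ (idx v + 1) * 1 := by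
        gcongr; exact h1 v x
    _ ≤ (1 / 2 : ℝ) ^ idx v := by
        rw [mul_one]
        exact pow_le_pow_of_le_one (by norm_num) (by norm_num) (by omega)

variable [TopologicalSpace K] {O : A → Set K} {rank : A → Ordinal.{u}}

theorem familyWeight_le_goodSup (h0 : ∀ a x, 0 ≤ ψ a x)
    (h1 : ∀ a x, ψ a x ≤ 1) {W : Set K} {p : Finset A} (hp : IsGood O rank W p) (x : K) :
    familyWeight ψ idx p x ≤ goodSup O rank ψ idx W x :=
  le_ciSup (f := fun p : {p : Finset A // IsGood O rank W p} => familyWeight ψ idx p x)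
    ⟨1, by rintro _ ⟨p, rfl⟩; exact familyWeight_le_one h0 h1 _ x⟩ ⟨p, hp⟩

theorem goodSup_nonneg (h0 : ∀ a x, 0 ≤ ψ a x)
    (W : Set K) (x : K) : 0 ≤ goodSup O rank ψ idx W x :=
  Real.iSup_nonneg fun p => familyWeight_nonneg h0 p.1 x

theorem exists_lt_familyWeight {W : Set K} {x : K} {ε : ℝ} (hε : 0 ≤ ε)
    (h : ε < goodSup O rank ψ idx W x) :
    ∃ p, IsGood O rank W p ∧ ε < familyWeight ψ idx p x := by
  cases isEmpty_or_nonempty {p : Finset A // IsGood O rank W p} with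
  | inl he =>
    rw [goodSup, Real.iSup_of_isEmpty] at h
    exact absurd h hε.not_gt
  | inr hn =>
    obtain ⟨p, hp⟩ := exists_lt_of_lt_ciSup h
    exact ⟨p.1, p.2, hp⟩

theorem goodSup_mono (h0 : ∀ a x, 0 ≤ ψ a x)
    (h1 : ∀ a x, ψ a x ≤ 1) {W W' : Set K} (h : W ⊆ W') (x : K) :
    goodSup O rank ψ idx W x ≤ goodSup O rank ψ idx W' x :=
  Real.iSup_le (fun p => familyWeight_le_goodSup h0 h1 (p.2.mono h) x) (goodSup_nonneg h0 W' x)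

/-- Joint upper semicontinuity in the set and the point. Families of weight above `ε` have a good
limit `R`, eventually contained in them, and passing to a subfamily only increases the weight. -/
theorem IsRankedFamily.le_goodSup_of_tendsto (hO : IsRankedFamily O rank idx)
    (h0 : ∀ a x, 0 ≤ ψ a x) (h1 : ∀ a x, ψ a x ≤ 1)
    (hψ : ∀ a, Continuous (ψ a)) {ι : Type*} (𝒰 : Ultrafilter ι) {W : ι → Set K} {W₀ : Set K}
    (hW : ∀ T, IsOpen T → T.Nonempty → Disjoint T W₀ →
      ∃ T' ⊆ T, IsOpen T' ∧ T'.Nonempty ∧ ∀ᶠ i in 𝒰, Disjoint T' (W i))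
    {x : ι → K} {x₀ : K} (hx : Tendsto x 𝒰 (𝓝 x₀)) {ε : ℝ} (hε : 0 < ε)
    (h : ∀ᶠ i in 𝒰, ε < goodSup O rank ψ idx (W i) (x i)) :
    ε ≤ goodSup O rank ψ idx W₀ x₀ := by
  have hp : ∀ i, ∃ p : Finset A, ε < goodSup O rank ψ idx (W i) (x i) →
      IsGood O rank (W i) p ∧ ε < familyWeight ψ idx p (x i) := fun i => by
    by_cases hi : ε < goodSup O rank ψ idx (W i) (x i)
    · obtain ⟨p, hp⟩ := exists_lt_familyWeight hε.le hi
      exact ⟨p, fun _ => hp⟩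
    · exact ⟨∅, fun h => absurd h hi⟩
  choose p hp using hp
  obtain ⟨k, hk⟩ := exists_pow_lt_of_lt_one hε (show (1 / 2 : ℝ) < 1 by norm_num)
  have hle : ∀ n, ε < (1 / 2 : ℝ) ^ n → n ≤ k := fun n hn => by
    by_contra hkn
    exact (hk.trans hn).not_ge
      (pow_le_pow_of_le_one (by norm_num) (by norm_num) (not_le.1 hkn).le)
  obtain ⟨R, hR, hRp⟩ := hO.exists_isGood_limit 𝒰 (k := k) (p := p) (W := W) (W₀ := W₀)
    (h.mono fun i hi => (hp i hi).1)
    (h.mono fun i hi => hle _ ((hp i hi).2.trans_le (familyWeight_le_pow_card h0 h1 _ _)))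
    (h.mono fun i hi v hv => hle _ ((hp i hi).2.trans_le (familyWeight_le_pow_idx h0 h1 hv _)))
    hW
  have hcont : Continuous (familyWeight ψ idx R) :=
    continuous_finsetProd _ fun v _ => continuous_const.mul (hψ v)
  refine (ge_of_tendsto ((hcont.tendsto x₀).comp hx) ?_).trans (familyWeight_le_goodSup h0 h1 hR x₀)
  filter_upwards [h, hRp] with i hi hi'
  exact (hp i hi).2.le.trans (familyWeight_anti h0 h1 hi' _)

theorem IsRankedFamily.continuous_goodSup (hO : IsRankedFamily O rank idx)
    (h0 : ∀ a x, 0 ≤ ψ a x) (h1 : ∀ a x, ψ a x ≤ 1)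
    (hψ : ∀ a, Continuous (ψ a)) (W : Set K) : Continuous (goodSup O rank ψ idx W) := by
  refine continuous_iff_continuousAt.2 fun x => tendsto_order.2 ⟨fun c hc => ?_, fun c hc => ?_⟩
  · rcases lt_or_ge c 0 with hc0 | hc0
    · exact Eventually.of_forall fun y => hc0.trans_le (goodSup_nonneg h0 W y)
    · obtain ⟨p, hp, hcp⟩ := exists_lt_familyWeight hc0 hc
      have hcont : Continuous (familyWeight ψ idx p) :=
        continuous_finsetProd _ fun v _ => continuous_const.mul (hψ v)
      filter_upwards [hcont.continuousAt.eventually (lt_mem_nhds hcp)] with y hy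
      exact hy.trans_le (familyWeight_le_goodSup h0 h1 hp y)
  · by_contra hcon
    obtain ⟨ε, hε, hεc⟩ := exists_between hc
    have hfreq : ∃ᶠ y in 𝓝 x, c ≤ goodSup O rank ψ idx W y := by
      refine fun h => hcon (h.mono fun y hy => not_le.1 hy)
    have : (𝓝 x ⊓ 𝓟 {y | c ≤ goodSup O rank ψ idx W y}).NeBot :=
      frequently_mem_iff_neBot.1 hfreq
    set 𝒰 := Ultrafilter.of (𝓝 x ⊓ 𝓟 {y | c ≤ goodSup O rank ψ idx W y})
    have h𝒰 : (𝒰 : Filter K) ≤ 𝓝 x ⊓ 𝓟 {y | c ≤ goodSup O rank ψ idx W y} := Ultrafilter.of_le _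
    refine (hO.le_goodSup_of_tendsto h0 h1 hψ 𝒰 (W := fun _ => W) (W₀ := W) (x := id) (ε := ε)
      (fun T hT hne hd => ⟨T, subset_rfl, hT, hne, Eventually.of_forall fun _ => hd⟩)
      (h𝒰.trans inf_le_left) ((goodSup_nonneg h0 W x).trans_lt hε) ?_).not_gt hε
    filter_upwards [(h𝒰.trans inf_le_right) (mem_principal_self _)] with y hy
    exact hεc.trans_le hy

end Weight

theorem IsRankedFamily.isQuasiKappaMetric {K : Type u} [TopologicalSpace K] {O : A → Set K}
    {rank : A → Ordinal.{u}} {idx : A → ℕ} (hO : IsRankedFamily O rank idx) {ψ : A → K → ℝ}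
    (h0 : ∀ a x, 0 ≤ ψ a x) (h1 : ∀ a x, ψ a x ≤ 1) (hψ : ∀ a, Continuous (ψ a))
    (hψO : ∀ a x, 0 < ψ a x ↔ x ∈ O a) :
    IsQuasiKappaMetric fun x (C : CanonicallyClosed K) =>
      goodSup O rank ψ idx (C : Set K)ᶜ x where
  nonneg x C := goodSup_nonneg h0 _ x
  zero_iff C := by
    have hV : IsOpen {x | 0 < goodSup O rank ψ idx (C : Set K)ᶜ x} :=
      isOpen_lt continuous_const (hO.continuous_goodSup h0 h1 hψ _)
    refine ⟨{x | 0 < goodSup O rank ψ idx (C : Set K)ᶜ x}, hV, ?_, ?_, fun x => ?_⟩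
    -- If `V` met `C`, it would meet the interior of `C` at some `y` where a good family has
    -- positive weight. All members then contain `y`, so goodness forces a part of that interior to
    -- meet the complement of `C`.
    · intro x hx hxC
      rw [← C.2] at hxC
      obtain ⟨y, hy, hyC⟩ := mem_closure_iff.1 hxC _ hV hx
      obtain ⟨p, hp, hpy⟩ := exists_lt_familyWeight le_rfl hy
      have hmem : ∀ v ∈ p, y ∈ O v := fun v hv => by
        rw [← hψO]
        refine lt_of_le_of_ne (h0 v y) fun h => hpy.ne' (Finset.prod_eq_zero hv ?_)
        rw [← h, mul_zero]
      obtain ⟨z, hz, hzC⟩ := hp.meets (interior (C : Set K) ∩ ⋂ v ∈ p, O v)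
        (isOpen_interior.inter (isOpen_biInter_finset fun v _ => hO.isOpen v))
        (fun v hv => ⟨y, ⟨hyC, Set.mem_iInter₂.2 hmem⟩, hmem v hv⟩)
        ⟨y, hyC, Set.mem_iInter₂.2 hmem⟩
      exact hzC (interior_subset hz.1)
    · intro x hx
      refine mem_closure_iff.2 fun G hG hxG => ?_
      have hC : IsClosed (C : Set K) := C.2 ▸ isClosed_closure
      obtain ⟨a, ha⟩ := hO.exists_subset _ (hG.inter hC.isOpen_compl) ⟨x, hxG, hx⟩
      -- Any family containing `a` meets the last condition of goodness. The extension retains a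
      -- common point, where its weight is positive.
      obtain ⟨q, haq, hq, hqc, -, hqne⟩ := hO.exists_isRankClosed (Order.succ (rank a)) {a}
        (by simpa [IsLinked] using hO.nonempty a) (by simp) Set.univ isOpen_univ
      obtain ⟨y, -, hy⟩ := hqne (by simpa using hO.nonempty a)
      rw [Set.mem_iInter₂] at hy
      have hgood : IsGood O rank (C : Set K)ᶜ q := ⟨hq, hqc, fun T _ hall _ =>
        (hall a (haq (by simp))).mono
          (Set.inter_subset_inter_right _ (ha.trans Set.inter_subset_right))⟩
      refine ⟨y, (ha (hy a (haq (by simp)))).1,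
        lt_of_lt_of_le ?_ (familyWeight_le_goodSup h0 h1 hgood y)⟩
      exact Finset.prod_pos fun v hv => mul_pos (by positivity) ((hψO v y).2 (hy v hv))
    · simp only [Set.mem_compl_iff, Set.mem_ofPred_eq, not_lt]
      exact ⟨fun h => h.le, fun h => h.antisymm (goodSup_nonneg h0 _ x)⟩
  anti C C' h x := goodSup_mono h0 h1 (Set.compl_subset_compl.2 h) x
  continuous C := hO.continuous_goodSup h0 h1 hψ _
  closureUnion ι _ _ _ C hC x := by
    refine le_antisymm (le_ciInf fun i => goodSup_mono h0 h1
      (Set.compl_subset_compl.2 ((Set.subset_iUnion (fun i => (C i : Set K)) i).trans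
        subset_closure)) x) (le_of_forall_lt fun c hc => ?_)
    have hbdd : BddBelow (Set.range fun i => goodSup O rank ψ idx (C i : Set K)ᶜ x) :=
      ⟨0, by rintro _ ⟨i, rfl⟩; exact goodSup_nonneg h0 _ x⟩
    rcases lt_or_ge c 0 with hc0 | hc0
    · exact hc0.trans_le (goodSup_nonneg h0 _ x)
    obtain ⟨ε, hcε, hε⟩ := exists_between hc
    -- K4 is the limit theorem at a fixed point: an open set inside the closed union meets the
    -- interior of some `C i`, and that intersection misses all later complements.
    refine hcε.trans_le (hO.le_goodSup_of_tendsto h0 h1 hψ (Ultrafilter.of atTop)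
      (W := fun i => (C i : Set K)ᶜ) ?_ (x := fun _ => x) tendsto_const_nhds (hc0.trans_lt hcε)
      (Eventually.of_forall fun i => hε.trans_le (ciInf_le hbdd i)))
    intro T hT ⟨y, hy⟩ hd
    have hyC : y ∈ closure (⋃ i, (C i : Set K)) := by
      by_contra h
      exact Set.disjoint_left.1 hd hy h
    obtain ⟨z, hzT, hz⟩ := mem_closure_iff.1 hyC T hT hy
    obtain ⟨i, hzi⟩ := Set.mem_iUnion.1 hz
    rw [← (C i).2] at hzi
    obtain ⟨w, hwT, hw⟩ := mem_closure_iff.1 hzi T hT hzT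
    refine ⟨T ∩ interior (C i : Set K), Set.inter_subset_left, hT.inter isOpen_interior,
      ⟨w, hwT, hw⟩, ?_⟩
    filter_upwards [Ultrafilter.of_le atTop (eventually_ge_atTop i)] with j hj
    exact Set.disjoint_compl_right_iff_subset.2
      ((Set.inter_subset_right.trans interior_subset).trans (hC hj))

end GoodSup

/-! ### From a winning strategy to a ranked family. -/

section PositiveFunctions

/-- The continuous real functions with a positive value. -/
abbrev SomewherePositive (X : Type*) [TopologicalSpace X] : Type _ :=
  {φ : C(X, ℝ) // ∃ x, 0 < φ x}

variable {X : Type u} [TopologicalSpace X]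

/-- The set where a function is positive. -/
def positiveSet (φ : SomewherePositive X) : Set X := {x | 0 < φ.1 x}

theorem isOpen_positiveSet (φ : SomewherePositive X) : IsOpen (positiveSet φ) :=
  isOpen_lt continuous_const φ.1.continuous

theorem nonempty_positiveSet (φ : SomewherePositive X) : (positiveSet φ).Nonempty := φ.2

theorem exists_positiveSet_subset [CompletelyRegularSpace X] {G : Set X} (hG : IsOpen G)
    (hne : G.Nonempty) : ∃ φ : SomewherePositive X, positiveSet φ ⊆ G := by
  obtain ⟨x, hx⟩ := hne
  obtain ⟨f, hf, hfx, hfG⟩ := CompletelyRegularSpace.completely_regular_isOpen x G hG hx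
  refine ⟨⟨⟨fun y => 1 - (f y : ℝ), by fun_prop⟩, x, by simp [hfx]⟩, fun y hy => ?_⟩
  by_contra hyG
  have h : f y = 1 := hfG hyG
  simp [positiveSet, h] at hy

/-- The nonempty open set where a function is positive. -/
def positiveOpens (φ : SomewherePositive X) : NonemptyOpens X :=
  ⟨⟨positiveSet φ, isOpen_positiveSet φ⟩, nonempty_positiveSet φ⟩

/-- Player I's strategy and the lattice operations, as operations on lists. -/
noncomputable def strategyOps (τ : List (SomewherePositive X) → SomewherePositive X) :
    ℕ → List (SomewherePositive X) → SomewherePositive X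
  | 1, [φ, χ] => ⟨φ.1 ⊔ χ.1, φ.2.imp fun _ h => lt_max_of_lt_left h⟩
  | 2, [φ, χ] => open Classical in
    -- The default `φ` adds nothing to a family that already contains the arguments.
    if h : ∃ x, 0 < (φ.1 ⊓ χ.1) x then ⟨φ.1 ⊓ χ.1, h⟩ else φ
  | _, l => τ l

theorem OpsClosed.exists_positiveSet_union
    {τ : List (SomewherePositive X) → SomewherePositive X} {E : Set (SomewherePositive X)}
    (hE : OpsClosed (strategyOps τ) E) {φ χ : SomewherePositive X} (hφ : φ ∈ E) (hχ : χ ∈ E) :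
    ∃ θ ∈ E, positiveSet θ = positiveSet φ ∪ positiveSet χ := by
  refine ⟨_, hE 1 [φ, χ] (by simp [hφ, hχ]), ?_⟩
  ext x
  simp [strategyOps, positiveSet]

theorem OpsClosed.exists_positiveSet_inter
    {τ : List (SomewherePositive X) → SomewherePositive X} {E : Set (SomewherePositive X)}
    (hE : OpsClosed (strategyOps τ) E) {φ χ : SomewherePositive X} (hφ : φ ∈ E) (hχ : χ ∈ E)
    (hne : (positiveSet φ ∩ positiveSet χ).Nonempty) :
    ∃ θ ∈ E, positiveSet θ = positiveSet φ ∩ positiveSet χ := by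
  have h : ∃ x, 0 < (φ.1 ⊓ χ.1) x := hne.imp fun x hx => lt_min hx.1 hx.2
  refine ⟨_, hE 2 [φ, χ] (by simp [hφ, hχ]), ?_⟩
  ext x
  simp only [strategyOps, dif_pos h]
  simp [positiveSet]

/-- A family closed under a winning strategy of player I contains a set all of whose subsets in
the family meet a given nonempty open set: otherwise player II could avoid that open set. -/
theorem exists_forall_subset_meets
    {τ : List (SomewherePositive X) → SomewherePositive X}
    (hτ : ∀ φ : ℕ → SomewherePositive X,
      (∀ n, positiveSet (φ n) ⊆ positiveSet (τ (List.ofFn fun i : Fin n => φ i))) →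
        Dense (⋃ n, positiveSet (φ n)))
    {E : Set (SomewherePositive X)} (hE : ∀ l, (∀ φ ∈ l, φ ∈ E) → τ l ∈ E)
    {G : Set X} (hG : IsOpen G) (hne : G.Nonempty) :
    ∃ θ ∈ E, ∀ φ ∈ E, positiveSet φ ⊆ positiveSet θ → (positiveSet φ ∩ G).Nonempty := by
  by_contra! hcon
  have : Nonempty (SomewherePositive X) := ⟨τ []⟩
  choose! g hgE hgsub hgG using hcon
  -- The history of the play in which player II always answers inside `E` with a set that misses
  -- `G`.
  let L : ℕ → List (SomewherePositive X) := fun n => (fun l => l ++ [g (τ l)])^[n] []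
  have hLsucc : ∀ n, L (n + 1) = L n ++ [g (τ (L n))] := fun n =>
    Function.iterate_succ_apply' ..
  have hLofFn : ∀ n, L n = List.ofFn fun i : Fin n => g (τ (L i)) := by
    intro n
    induction n with
    | zero => simp [L]
    | succ n ih => rw [hLsucc, List.ofFn_succ', List.concat_eq_append]; simp [← ih]
  have hLE : ∀ n, ∀ φ ∈ L n, φ ∈ E := by
    intro n
    induction n with
    | zero => simp [L]
    | succ n ih =>
      intro φ hφ
      rw [hLsucc, List.mem_append, List.mem_singleton] at hφ
      rcases hφ with h | rfl
      exacts [ih φ h, hgE _ (hE _ ih)]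
  have hdense := hτ (fun n => g (τ (L n))) fun n => by
    rw [← hLofFn n]
    exact hgsub _ (hE _ (hLE n))
  obtain ⟨x, hxG, hx⟩ := hdense.inter_open_nonempty G hG hne
  obtain ⟨n, hn⟩ := Set.mem_iUnion.1 hx
  exact (hgG _ (hE _ (hLE n))).le ⟨hn, hxG⟩

theorem IsIFavorable.exists_isRankedFamily [CompletelyRegularSpace X] (hX : IsIFavorable X) :
    ∃ (rank : SomewherePositive X → Ordinal.{u}) (idx : SomewherePositive X → ℕ),
      IsRankedFamily positiveSet rank idx := by
  obtain ⟨σ, hσ⟩ := hX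
  choose τ hτ using fun l : List (SomewherePositive X) =>
    exists_positiveSet_subset (σ (l.map positiveOpens)).1.isOpen (σ (l.map positiveOpens)).2
  have hτwin : ∀ φ : ℕ → SomewherePositive X,
      (∀ n, positiveSet (φ n) ⊆ positiveSet (τ (List.ofFn fun i : Fin n => φ i))) →
        Dense (⋃ n, positiveSet (φ n)) := fun φ hφ =>
    hσ (fun n => positiveOpens (φ n)) fun n => by
      have h := (hφ n).trans (hτ _)
      rw [List.map_ofFn] at h
      exact h
  have hreg : ∀ E, OpsClosed (strategyOps τ) E → IsRegularSubfamily positiveSet E := by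
    refine fun E hE => ⟨fun G hG hne => ?_, fun φ hφ χ hχ => hE.exists_positiveSet_union hφ hχ⟩
    obtain ⟨θ, hθ, h⟩ := exists_forall_subset_meets hτwin (fun l hl => hE 0 l hl) hG hne
    refine ⟨θ, hθ, fun φ hφ hmeet => ?_⟩
    -- Closure under meets turns a member that intersects `θ` into a member below `θ`, to which the
    -- game argument applies.
    obtain ⟨χ, hχ, hχe⟩ := hE.exists_positiveSet_inter hφ hθ hmeet
    refine (h χ hχ (hχe ▸ Set.inter_subset_right)).mono (Set.inter_subset_inter_left _ ?_)
    exact hχe ▸ Set.inter_subset_left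
  have huniv : OpsClosed (strategyOps τ) Set.univ := fun _ _ _ => Set.mem_univ _
  obtain ⟨rank, idx, hinj, hfin⟩ := huniv.exists_rank
  refine ⟨rank, idx, isOpen_positiveSet, nonempty_positiveSet,
    fun G hG hne => exists_positiveSet_subset hG hne, fun φ χ => ?_,
    fun φ χ => hinj φ trivial χ trivial, fun ξ => ?_⟩
  · obtain ⟨θ, -, hθ⟩ := huniv.exists_positiveSet_union (Set.mem_univ φ) (Set.mem_univ χ)
    exact ⟨θ, hθ⟩
  · obtain ⟨F, hF, hFc, hFe⟩ := hfin ξ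
    exact ⟨F, hF, fun E hE => hreg E (hFc E hE), by simpa using hFe⟩

/-- Completely regular I-favorable spaces are quasi `κ`-metrizable. -/
theorem IsIFavorable.quasiKappaMetrizable [CompletelyRegularSpace X] (hX : IsIFavorable X) :
    QuasiKappaMetrizable X := by
  obtain ⟨rank, idx, hO⟩ := hX.exists_isRankedFamily
  exact ⟨_, hO.isQuasiKappaMetric (ψ := fun φ x => max 0 (min 1 (φ.1 x)))
    (fun φ x => le_max_left _ _) (fun φ x => max_le zero_le_one (min_le_left _ _))
    (fun φ => by fun_prop) fun φ x => by simp [positiveSet]⟩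

end PositiveFunctions

/-! ### Passage between `X` and its Stone–Čech compactification. -/

section StoneCech

variable {X : Type u} [TopologicalSpace X]

/-- Player I simulates a play on `X` with the traces of player II's moves, nonempty by density, and
answers with an open set whose trace lies in the move prescribed there. -/
theorem IsIFavorable.stoneCech [CompletelyRegularSpace X] (hX : IsIFavorable X) :
    IsIFavorable (StoneCech X) := by
  obtain ⟨σ, hσ⟩ := hX
  have hdi : IsDenseInducing (stoneCechUnit : X → StoneCech X) := isDenseInducing_stoneCechUnit
  let res : NonemptyOpens (StoneCech X) → NonemptyOpens X := fun V =>
    ⟨V.1.comap ⟨_, continuous_stoneCechUnit⟩, hdi.dense.exists_mem_open V.1.isOpen V.2⟩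
  have hext : ∀ U : NonemptyOpens X, ∃ V : NonemptyOpens (StoneCech X), res V ≤ U := by
    intro U
    obtain ⟨V, hV, hVU⟩ := hdi.isInducing.isOpen_iff.1 U.1.isOpen
    obtain ⟨x, hx⟩ := U.2
    refine ⟨⟨⟨V, hV⟩, stoneCechUnit x, ?_⟩, fun y hy => ?_⟩
    · rw [← hVU] at hx
      exact hx
    · change y ∈ (U.1 : Set X)
      rw [← hVU]
      exact hy
  choose ext hext using hext
  refine ⟨fun l => ext (σ (l.map res)), fun V hV => ?_⟩
  have hd := hσ (fun n => res (V n)) fun n => by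
    have h := hV n
    beta_reduce at h
    rw [List.map_ofFn] at h
    exact le_trans (fun x hx => h hx) (hext _)
  refine (hdi.dense.dense_image continuous_stoneCechUnit hd).mono ?_
  rintro _ ⟨x, hx, rfl⟩
  obtain ⟨n, hn⟩ := Set.mem_iUnion.1 hx
  exact Set.mem_iUnion.2 ⟨n, hn⟩

theorem stoneCechUnit_mem_closureStoneCech_iff [T35Space X] (C : CanonicallyClosed X) (x : X) :
    stoneCechUnit x ∈ (C.closureStoneCech : Set (StoneCech X)) ↔ x ∈ (C : Set X) := by
  have hC : IsClosed (C : Set X) := C.2 ▸ isClosed_closure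
  change stoneCechUnit x ∈ closure (stoneCechUnit '' (C : Set X)) ↔ _
  rw [← Set.mem_preimage,
    ← isDenseInducing_stoneCechUnit.isInducing.closure_eq_preimage_closure_image, hC.closure_eq]

theorem closureStoneCech_closureUnion [T35Space X] {ι : Type*} (C : ι → CanonicallyClosed X) :
    (CanonicallyClosed.closureUnion C).closureStoneCech =
      CanonicallyClosed.closureUnion fun i => (C i).closureStoneCech := by
  refine Subtype.ext ?_
  change closure (stoneCechUnit '' closure (⋃ i, (C i : Set X))) =
    closure (⋃ i, closure (stoneCechUnit '' (C i : Set X)))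
  rw [closure_image_closure continuous_stoneCechUnit, Set.image_iUnion]
  exact (closure_mono (Set.iUnion_mono fun i => subset_closure)).antisymm
    (closure_minimal (Set.iUnion_subset fun i => closure_mono
      (Set.subset_iUnion (fun i => stoneCechUnit '' (C i : Set X)) i))
      isClosed_closure)

/-- A quasi `κ`-metric on `βX` restricts to `X`. -/
theorem IsQuasiKappaMetric.restrictStoneCech [T35Space X]
    {d : StoneCech X → CanonicallyClosed (StoneCech X) → ℝ} (hd : IsQuasiKappaMetric d) :
    IsQuasiKappaMetric (restrictStoneCech d) where
  nonneg x C := hd.nonneg _ _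
  zero_iff C := by
    obtain ⟨V, hV, hVC, hCV, hzero⟩ := hd.zero_iff C.closureStoneCech
    refine ⟨stoneCechUnit ⁻¹' V, hV.preimage continuous_stoneCechUnit,
      fun x hx hxC => hVC hx ((stoneCechUnit_mem_closureStoneCech_iff C x).2 hxC),
      fun x hx => ?_, fun x => hzero _⟩
    have hxV : stoneCechUnit x ∈ closure V :=
      hCV fun h => hx ((stoneCechUnit_mem_closureStoneCech_iff C x).1 h)
    -- Since `X` is dense and `V` is open, the trace of `V` on `X` has the same closure in `βX` as
    -- `V`.
    rw [isDenseInducing_stoneCechUnit.isInducing.closure_eq_preimage_closure_image,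
      Set.image_preimage_eq_inter_range]
    exact closure_minimal (Dense.open_subset_closure_inter denseRange_stoneCechUnit hV)
      isClosed_closure hxV
  anti C C' h x := hd.anti _ _ (closure_mono (Set.image_mono h)) _
  continuous C := (hd.continuous _).comp continuous_stoneCechUnit
  closureUnion ι _ _ _ C hC x := by
    change d _ _ = _
    rw [closureStoneCech_closureUnion]
    exact hd.closureUnion ι _ (fun i j h => closure_mono (Set.image_mono (hC h))) _

end StoneCech

theorem corollary1p5 {X : Type u} [TopologicalSpace X] [T35Space X] (hX : IsIFavorable X) :
    QuasiKappaMetrizable X ∧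
      ∃ d : StoneCech X → CanonicallyClosed (StoneCech X) → ℝ,
        IsQuasiKappaMetric d ∧ IsQuasiKappaMetric (restrictStoneCech d) := by
  obtain ⟨d, hd⟩ := hX.stoneCech.quasiKappaMetrizable
  exact ⟨⟨_, hd.restrictStoneCech⟩, d, hd, hd.restrictStoneCech⟩
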